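/- Let $\phi(\lambda)=\int_{(0,\infty)}(1-e^{-\lambda s})\,\nu(ds)$, $\lambda>0$, be a Bernstein function whose Lévy measure $\nu$ on $(0,\infty)$ satisfies $\int (1\wedge s)\,\nu(ds)<\infty$ and $\nu(0,\infty)=\infty$ (for instance $\phi(\lambda)=\lambda^\alpha$, $\alpha\in(0,1)$). For $(x,v)\in\mathbb{R}^2$ let $\mathbb{P}^{(x,v)}$ be a probability measure under which $B$ is a one-dimensional Brownian motion started at $x$, and $\sigma$ is a process independent of $B$ with $\sigma(0)=v$ such that $\sigma_0=\sigma-\sigma(0)$ is a (right-continuous, nondecreasing) subordinator with Laplace exponent $\phi$. Put, for $t\ge 0$, $$L(t)=\inf\{u\ge0:\sigma(u)>t\},\quad H(t)=\sigma_0(L(t)-),\quad \gamma(t)=t-\sigma(L(t)-),\quad X_{\rm e}(t)=B(H(t)),\quad X(t)=e^{X_{\rm e}(t)},$$ with the convention $\sigma(0-)=\sigma(0)$. For $T>0$ let $\widetilde{\mathbb{P}}^{(x,v)}$ be the measure $$\widetilde{\mathbb{P}}^{(x,v)}(A)=\mathbb{E}^{(x,v)}\left[\mathbf{1}_A\,e^{-\frac{X_{\rm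 e}(T)-x}{2}-\frac{H(T)}{8}}\right].$$ Then, for every $T>0$ and $(x,v)\in\mathbb{R}^2$, $\widetilde{\mathbb{P}}^{(x,v)}$ is a probability measure, and the distribution of the process $\{(X(t),\gamma(t)),\ t\in[0,T]\}$ under $\widetilde{\mathbb{P}}^{(x,v)}$ coincides with the distribution of $\{(X(t)e^{-H(t)/2},\gamma(t)),\ t\in[0,T]\}$ under $\mathbb{P}^{(x,v)}$. -/

import Mathlib

open MeasureTheory ProbabilityTheory
open scoped NNReal ENNReal

noncomputable section

/-- Bernstein functions with Lévy triplet `(0, 0, ν)` and infinite Lévy measure `ν` on `(0, ∞)`,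
i.e. `φ(l) = ∫ (1 - exp (-l s)) ν(ds)` for `l > 0`, with `∫ min(1, s) ν(ds) < ∞`. -/
def IsBernsteinZero (φ : ℝ → ℝ) : Prop :=
  ∃ ν : Measure ℝ, ν (Set.Iic 0) = 0 ∧ ν (Set.Ioi 0) = ∞ ∧
    ∫⁻ s, ENNReal.ofReal (min 1 s) ∂ν < ∞ ∧
    ∀ l : ℝ, 0 < l → φ l = ∫ s, (1 - Real.exp (-l * s)) ∂ν

/-- `S` is, under `P`, a subordinator with Laplace exponent `φ`: a process started at `0` with
independent and stationary increments and almost surely nondecreasing right-continuous paths,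
such that `E[exp (-l S(t))] = exp (-t φ(l))`. -/
structure IsSubordinator {Ω : Type*} [MeasurableSpace Ω] (φ : ℝ → ℝ) (S : ℝ≥0 → Ω → ℝ)
    (P : Measure Ω) : Prop where
  aemeasurable : ∀ t, AEMeasurable (S t) P
  zero : ∀ᵐ ω ∂P, S 0 ω = 0
  indepIncrements : HasIndepIncrements S P
  stationaryIncrements : ∀ s t : ℝ≥0, IdentDistrib (fun ω => S (s + t) ω - S s ω) (S t) P P
  monotone : ∀ᵐ ω ∂P, Monotone (fun t => S t ω)
  rightContinuous : ∀ᵐ ω ∂P, ∀ t, ContinuousWithinAt (fun u => S u ω) (Set.Ici t) t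
  laplace : ∀ (t : ℝ≥0) (l : ℝ), 0 < l →
    ∫ ω, Real.exp (-l * S t ω) ∂P = Real.exp (-(t : ℝ) * φ l)

/-- `P` plays the role of `P^(x,v)`: under `P`, `B` is a Brownian motion started at `x`, `σ` is a
process started at `v` such that `σ - σ(0)` is a subordinator with Laplace exponent `φ`,
and the processes `B` and `σ` are independent. -/
structure IsBrownianSubordinatorPair {Ω : Type*} [MeasurableSpace Ω] (φ : ℝ → ℝ) (x v : ℝ)
    (B σ : ℝ≥0 → Ω → ℝ) (P : Measure Ω) : Prop where
  brownian : IsBrownianReal (fun t ω => B t ω - x) P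
  start : ∀ᵐ ω ∂P, σ 0 ω = v
  subordinator : IsSubordinator φ (fun t ω => σ t ω - σ 0 ω) P
  indep : IndepFun (fun ω (t : ℝ≥0) => B t ω) (fun ω (t : ℝ≥0) => σ t ω) P

/-- The first passage (inverse) process `L(t) = inf {u ≥ 0 : σ(u) > t}`. -/
def firstPassage {Ω : Type*} (σ : ℝ≥0 → Ω → ℝ) (t : ℝ≥0) (ω : Ω) : ℝ≥0 :=
  sInf {u : ℝ≥0 | (t : ℝ) < σ u ω}

/-- The undershoot `H(t) = σ₀(L(t)-)`, where `σ₀ = σ - σ(0)`. `Function.leftLim` has the value of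
the function at time `0`, which is the convention `σ₀(0-) = σ₀(0)`. -/
def undershoot {Ω : Type*} (σ : ℝ≥0 → Ω → ℝ) (t : ℝ≥0) (ω : Ω) : ℝ :=
  Function.leftLim (fun u : ℝ≥0 => σ u ω - σ 0 ω) (firstPassage σ t ω)

/-- The age process `γ(t) = t - σ(L(t)-)`. -/
def age {Ω : Type*} (σ : ℝ≥0 → Ω → ℝ) (t : ℝ≥0) (ω : Ω) : ℝ :=
  (t : ℝ) - Function.leftLim (fun u : ℝ≥0 => σ u ω) (firstPassage σ t ω)

/-- The time-changed process `X_e(t) = B(H(t))`. -/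
def logPrice {Ω : Type*} (B σ : ℝ≥0 → Ω → ℝ) (t : ℝ≥0) (ω : Ω) : ℝ :=
  B (undershoot σ t ω).toNNReal ω

/-- The price process `X(t) = exp (X_e(t)) = exp (B(H(t)))`. -/
def price {Ω : Type*} (B σ : ℝ≥0 → Ω → ℝ) (t : ℝ≥0) (ω : Ω) : ℝ :=
  Real.exp (logPrice B σ t ω)

/-- The changed measure, with density `exp (-(X_e(T) - x) / 2 - H(T) / 8)` with respect to `P`;
the factor `exp (x / 2)` makes it a probability measure when `B` starts at `x`. -/
def changedMeasure {Ω : Type*} [MeasurableSpace Ω] (B σ : ℝ≥0 → Ω → ℝ) (x : ℝ) (T : ℝ≥0)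
    (P : Measure Ω) : Measure Ω :=
  P.withDensity fun ω =>
    ENNReal.ofReal (Real.exp (-(logPrice B σ T ω - x) / 2 - undershoot σ T ω / 8))

end

/-! By independence, the path of `σ` can be frozen. Then `H` and `γ` are deterministic on `[0, T]`,
`H` is nondecreasing, and the density is the Girsanov density of `B` at the fixed time `H(T)` with
drift `θ = -1/2`, since `θ ^ 2 / 2 = 1/8`. The tilt turns `B(u)` into `B(u) - u / 2` for `u ≤ H(T)`,
so `X(t)` acquires the factor `exp (-H(t) / 2)` and `γ` is untouched
(`withDensity_densityPath_apply`). Fubini over the law of `σ` concludes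
(`map_priceAgePath_withDensity`). For measurability, everything is first written as a functional of
the two paths at rational times, through `evalPath_eq` and `leftLim_sInf_eq_undershootPath`. -/

/-! ### Unboundedness of the subordinator. -/

theorem IsBernsteinZero.pos {φ : ℝ → ℝ} (hφ : IsBernsteinZero φ) : 0 < φ 1 := by
  obtain ⟨ν, h0, hinf, hfin, hφ⟩ := hφ
  have hpos : ∀ᵐ s ∂ν, 0 < s := by
    rw [ae_iff]
    simpa [Set.Iic] using h0
  have hbound : ∀ᵐ s ∂ν, ‖1 - Real.exp (-1 * s)‖ ≤ min 1 s := by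
    filter_upwards [hpos] with s hs
    have h1 : Real.exp (-1 * s) ≤ 1 := Real.exp_le_one_iff.2 (by linarith)
    rw [Real.norm_of_nonneg (by linarith)]
    refine le_min (by linarith [Real.exp_pos (-1 * s)]) ?_
    linarith [Real.add_one_le_exp (-1 * s)]
  have hmin : Integrable (fun s : ℝ => min 1 s) ν := by
    refine ⟨by fun_prop, ?_⟩
    rw [hasFiniteIntegral_iff_norm]
    refine lt_of_le_of_lt (lintegral_mono_ae ?_) hfin
    filter_upwards [hpos] with s hs
    rw [Real.norm_of_nonneg (by positivity)]
  rw [hφ 1 one_pos, integral_pos_iff_support_of_nonneg_ae]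
  · refine lt_of_lt_of_le (b := ν (Set.Ioi 0)) (by simp [hinf]) (measure_mono fun s hs => ?_)
    have : Real.exp (-1 * s) < 1 := Real.exp_lt_one_iff.2 (by linarith [Set.mem_Ioi.1 hs])
    exact (sub_pos.2 this).ne'
  · filter_upwards [hpos] with s hs
    have : Real.exp (-1 * s) ≤ 1 := Real.exp_le_one_iff.2 (by linarith)
    simpa using this
  · exact hmin.mono' (by fun_prop) hbound

/-- Markov's inequality for `exp (-S n)` bounds the probability of staying below `k` by `exp (k - n
φ(1))`, which tends to `0`. This keeps the first-passage sets nonempty, so `sInf` never takes its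
default value there. -/
theorem IsSubordinator.ae_unbounded {Ω : Type*} [MeasurableSpace Ω] {P : Measure Ω}
    {φ : ℝ → ℝ} {S : ℝ≥0 → Ω → ℝ} (hS : IsSubordinator φ S P) (hφ : 0 < φ 1) :
    ∀ᵐ ω ∂P, ∀ a : ℝ, ∃ u, a < S u ω := by
  suffices h : ∀ k : ℕ, ∀ᵐ ω ∂P, ∃ n : ℕ, (k : ℝ) < S n ω by
    filter_upwards [ae_all_iff.2 h] with ω hω a
    obtain ⟨k, hk⟩ := exists_nat_ge a
    obtain ⟨n, hn⟩ := hω k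
    exact ⟨n, hk.trans_lt hn⟩
  intro k
  have hle (n : ℕ) : P {ω | ¬ ∃ n : ℕ, (k : ℝ) < S n ω} ≤
      ENNReal.ofReal (Real.exp k * Real.exp (-(n : ℝ) * φ 1)) := by
    have hint := hS.laplace n 1 one_pos
    have hI : Integrable (fun ω => Real.exp (-1 * S n ω)) P := by
      by_contra hc
      rw [integral_undef hc] at hint
      exact (Real.exp_pos _).ne hint
    have hmk := mul_meas_ge_le_lintegral₀ (μ := P)
      (f := fun ω => ENNReal.ofReal (Real.exp (-1 * S n ω)))
      hI.aestronglyMeasurable.aemeasurable.ennreal_ofReal (ENNReal.ofReal (Real.exp (-k)))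
    rw [← ofReal_integral_eq_lintegral_ofReal hI
      (by filter_upwards with ω using (Real.exp_pos _).le), hint] at hmk
    calc P {ω | ¬ ∃ n : ℕ, (k : ℝ) < S n ω}
        ≤ P {ω | ENNReal.ofReal (Real.exp (-k)) ≤ ENNReal.ofReal (Real.exp (-1 * S n ω))} := by
          refine measure_mono fun ω hω => ?_
          simp only [Set.mem_ofPred_eq, not_exists, not_lt] at hω ⊢
          exact ENNReal.ofReal_le_ofReal (Real.exp_le_exp.2 (by linarith [hω n]))
      _ = ENNReal.ofReal (Real.exp k) * (ENNReal.ofReal (Real.exp (-k)) *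
            P {ω | ENNReal.ofReal (Real.exp (-k)) ≤ ENNReal.ofReal (Real.exp (-1 * S n ω))}) := by
          rw [← mul_assoc, ← ENNReal.ofReal_mul (Real.exp_pos _).le, ← Real.exp_add]
          simp
      _ ≤ _ := by
          rw [ENNReal.ofReal_mul (Real.exp_pos _).le]
          gcongr
          simpa using hmk
  rw [ae_iff]
  refine le_antisymm (ge_of_tendsto' (x := Filter.atTop) ?_ hle) zero_le
  rw [show (0 : ℝ≥0∞) = ENNReal.ofReal (Real.exp k * 0) by simp]
  refine ENNReal.tendsto_ofReal (Filter.Tendsto.const_mul _ (Real.tendsto_exp_atBot.comp ?_))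
  simp_rw [neg_mul]
  exact Filter.tendsto_neg_atTop_atBot.comp
    (tendsto_natCast_atTop_atTop.atTop_mul_const hφ)

/-! ### Path functionals on rational times. -/

/-- The value at time `h` of a path known at rational times, when this path is continuous. -/
noncomputable def evalPath (w : ℚ≥0 → ℝ) (h : ℝ≥0) : ℝ :=
  Filter.limsup (fun n : ℕ => w (⌊(n + 1 : ℝ≥0) * h⌋₊ / (n + 1))) Filter.atTop

theorem measurable_evalPath : Measurable fun p : (ℚ≥0 → ℝ) × ℝ≥0 => evalPath p.1 p.2 := by
  refine Measurable.limsup fun n => ?_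
  have h1 : Measurable fun p : (ℚ≥0 → ℝ) × ℕ => p.1 ((p.2 : ℚ≥0) / (n + 1)) :=
    measurable_from_prod_countable_left fun k => measurable_pi_apply ((k : ℚ≥0) / (n + 1))
  exact h1.comp (measurable_fst.prodMk
    (Nat.measurable_floor.comp (measurable_snd.const_mul _)))

theorem Measurable.evalPath {α : Type*} [MeasurableSpace α] {f : α → ℚ≥0 → ℝ} {g : α → ℝ≥0}
    (hf : Measurable f) (hg : Measurable g) : Measurable fun a => evalPath (f a) (g a) :=
  Measurable.comp (g := fun p : (ℚ≥0 → ℝ) × ℝ≥0 => _root_.evalPath p.1 p.2)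
    (f := fun a => (f a, g a)) measurable_evalPath (hf.prodMk hg)

theorem evalPath_eq {f : ℝ≥0 → ℝ} (hf : Continuous f) (h : ℝ≥0) :
    evalPath (fun q => f q) h = f h := by
  refine Filter.Tendsto.limsup_eq ?_
  have h1 : Filter.Tendsto (fun n : ℕ => (⌊(n + 1 : ℝ≥0) * h⌋₊ / (n + 1) : ℝ≥0)) Filter.atTop
      (nhds h) := by
    have h2 := (tendsto_nat_floor_mul_div_atTop (R := ℝ) h.2).comp
      (tendsto_natCast_atTop_atTop.comp (Filter.tendsto_add_atTop_nat 1))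
    rw [← NNReal.tendsto_coe]
    refine h2.congr fun n => ?_
    have : ⌊(h : ℝ) * (n + 1)⌋₊ = ⌊(n + 1 : ℝ≥0) * h⌋₊ := by
      rw [mul_comm]
      exact Nonneg.nat_floor_coe (α := ℝ) ((n + 1 : ℝ≥0) * h)
    simp [← this]
  refine ((hf.tendsto h).comp h1).congr fun n => ?_
  simp

/-- The undershoot of the level `t`, as a functional of a path known at rational times. -/
noncomputable def undershootPath (w : ℚ≥0 → ℝ) (t : ℝ≥0) : ℝ≥0 :=
  ⨆ p : ℚ≥0 × ℚ≥0, if p.1 < p.2 ∧ w p.2 ≤ t then (min (w p.1) t - w 0).toNNReal else 0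

/-- The cap `min (w p.1) t` makes this true for every `w`, monotone or not; hence
`monotone_undershootPath` needs no exceptional set of paths. -/
theorem bddAbove_undershootPath (w : ℚ≥0 → ℝ) (t : ℝ≥0) :
    BddAbove (Set.range fun p : ℚ≥0 × ℚ≥0 =>
      if p.1 < p.2 ∧ w p.2 ≤ t then (min (w p.1) t - w 0).toNNReal else 0) := by
  refine ⟨(t - w 0 : ℝ).toNNReal, ?_⟩
  rintro _ ⟨p, rfl⟩
  dsimp only
  split_ifs
  · exact Real.toNNReal_le_toNNReal (by linarith [min_le_right (w p.1) t])
  · exact zero_le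

theorem monotone_undershootPath (w : ℚ≥0 → ℝ) : Monotone (undershootPath w) := by
  intro s t hst
  have hst' : (s : ℝ) ≤ t := hst
  refine ciSup_mono (bddAbove_undershootPath w t) fun p => ?_
  by_cases h : p.1 < p.2 ∧ w p.2 ≤ s
  · rw [if_pos h, if_pos ⟨h.1, h.2.trans hst'⟩]
    gcongr
  · rw [if_neg h]
    exact zero_le

theorem measurable_undershootPath (t : ℝ≥0) : Measurable fun w => undershootPath w t := by
  refine Measurable.iSup fun p => ?_
  refine Measurable.ite ?_ (by fun_prop) measurable_const
  by_cases h : p.1 < p.2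
  · simpa [h] using measurableSet_le (measurable_pi_apply p.2) measurable_const
  · simp [h]

theorem leftLim_sub_const {w : ℝ≥0 → ℝ} (hw : Monotone w) (c : ℝ) (a : ℝ≥0) :
    Function.leftLim (fun u => w u - c) a = Function.leftLim w a - c := by
  rcases eq_or_ne a 0 with rfl | ha
  · rw [leftLim_eq_of_isBot fun _ => zero_le, leftLim_eq_of_isBot fun _ => zero_le]
  · have : (nhdsWithin a (Set.Iio a)).NeBot := nhdsLT_neBot_of_exists_lt ⟨0, pos_of_ne_zero ha⟩
    exact leftLim_eq_of_tendsto ((hw.tendsto_leftLim a).sub_const c)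

theorem exists_nnratCast_btwn {a b : ℝ≥0} (h : a < b) : ∃ q : ℚ≥0, a < q ∧ (q : ℝ≥0) < b := by
  obtain ⟨q, h1, h2⟩ := exists_rat_btwn (NNReal.coe_lt_coe.2 h)
  have hq : (0 : ℝ) < q := a.2.trans_lt h1
  lift q to ℚ≥0 using by exact_mod_cast hq.le
  exact ⟨q, by exact_mod_cast h1, by exact_mod_cast h2⟩

/-- A rational `q` satisfies `q < L` iff some rational `r > q` has `w r ≤ t`. The gap `q < r`
matters: `w r ≤ t` only gives `r ≤ L`, and `w L` may exceed the left limit. -/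
theorem leftLim_sInf_eq_undershootPath {w : ℝ≥0 → ℝ} (hw : Monotone w)
    (hunb : ∀ a : ℝ, ∃ u, a < w u) (t : ℝ≥0) :
    Function.leftLim (fun u => w u - w 0) (sInf {u : ℝ≥0 | (t : ℝ) < w u}) =
      undershootPath (fun q => w q) t := by
  set L := sInf {u : ℝ≥0 | (t : ℝ) < w u} with hL
  have hmono : Monotone fun u => w u - w 0 := fun a b hab => sub_le_sub_right (hw hab) _
  have hlt {u : ℝ≥0} (hu : u < L) : w u ≤ t := not_lt.1 fun h => notMem_of_lt_csInf' hu h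
  have hnonneg : 0 ≤ Function.leftLim (fun u => w u - w 0) L := by
    rcases eq_or_ne L 0 with h0 | h0
    · rw [h0, leftLim_eq_of_isBot fun _ => zero_le, sub_self]
    · simpa using hmono.le_leftLim (pos_of_ne_zero h0)
  apply le_antisymm
  · rcases eq_or_ne L 0 with h0 | h0
    · rw [h0, leftLim_eq_of_isBot fun _ => zero_le, sub_self]
      positivity
    · have : (nhdsWithin L (Set.Iio L)).NeBot := nhdsLT_neBot_of_exists_lt ⟨0, pos_of_ne_zero h0⟩
      rw [hmono.leftLim_eq_sSup]
      refine csSup_le (Set.Nonempty.image _ ⟨0, pos_of_ne_zero h0⟩) ?_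
      rintro _ ⟨u, hu, rfl⟩
      obtain ⟨q, huq, hqL⟩ := exists_nnratCast_btwn hu
      obtain ⟨r, hqr, hrL⟩ := exists_nnratCast_btwn hqL
      have hterm := le_ciSup (bddAbove_undershootPath (fun q => w q) t) (q, r)
      rw [if_pos ⟨by exact_mod_cast hqr, hlt hrL⟩] at hterm
      refine le_trans ?_ (NNReal.coe_le_coe.2 hterm)
      dsimp only
      rw [min_eq_left (hlt hqL), NNRat.cast_zero, Real.coe_toNNReal _ (sub_nonneg.2 (hw zero_le))]
      exact hmono huq.le
  · rw [← Real.coe_toNNReal _ hnonneg, NNReal.coe_le_coe]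
    refine ciSup_le fun p => ?_
    split_ifs with h
    · refine Real.toNNReal_le_toNNReal ?_
      have hrL : (p.2 : ℝ≥0) ≤ L := le_csInf (hunb t) fun u hu =>
        le_of_not_gt fun hlt => (h.2.trans_lt hu).not_ge (hw hlt.le)
      have hqr : (p.1 : ℝ≥0) < p.2 := by exact_mod_cast h.1
      refine le_trans ?_ (hmono.le_leftLim (hqr.trans_le hrL))
      simp
    · exact zero_le

attribute [irreducible] evalPath undershootPath

/-! ### Exponential tilting of Gaussian variables. -/

section Tilt

variable {Ω : Type*} [MeasurableSpace Ω] {P : Measure Ω}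

theorem ProbabilityTheory.HasGaussianLaw.mgf_eq_of_centered {Z : Ω → ℝ} (h : HasGaussianLaw Z P)
    (hZ : P[Z] = 0) (s : ℝ) : mgf Z P s = Real.exp (Var[Z; P] * s ^ 2 / 2) := by
  rw [mgf_gaussianReal h.map_eq_gaussianReal, hZ, Real.coe_toNNReal _ (variance_nonneg _ _)]
  simp

/-- The density of the exponential change of measure along a centered Gaussian variable. -/
noncomputable def gaussianTilt (W : Ω → ℝ) (P : Measure Ω) (θ : ℝ) : Measure Ω :=
  P.withDensity fun ω => ENNReal.ofReal (Real.exp (θ * W ω - θ ^ 2 * Var[W; P] / 2))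

theorem integral_gaussianTilt {W : Ω → ℝ} (hW : AEMeasurable W P) (θ : ℝ) (f : Ω → ℝ) :
    ∫ ω, f ω ∂gaussianTilt W P θ =
      ∫ ω, Real.exp (θ * W ω - θ ^ 2 * Var[W; P] / 2) * f ω ∂P := by
  rw [gaussianTilt, integral_withDensity_eq_integral_toReal_smul₀ (by fun_prop) (by simp)]
  simp [Real.exp_nonneg]

theorem isProbabilityMeasure_gaussianTilt {W : Ω → ℝ} (h : HasGaussianLaw W P)
    (hW : P[W] = 0) (θ : ℝ) : IsProbabilityMeasure (gaussianTilt W P θ) := by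
  have hm := h.mgf_eq_of_centered hW θ
  have hI : Integrable (fun ω => Real.exp (θ * W ω)) P := by
    by_contra hc
    rw [mgf, integral_undef hc] at hm
    exact (Real.exp_pos _).ne hm
  constructor
  rw [gaussianTilt, withDensity_apply _ .univ, Measure.restrict_univ,
    ← ofReal_integral_eq_lintegral_ofReal ?_ (by filter_upwards with ω using (Real.exp_pos _).le)]
  · simp_rw [Real.exp_sub, integral_div]
    rw [← mgf, hm, mul_comm, div_self (Real.exp_ne_zero _), ENNReal.ofReal_one]
  · simp_rw [Real.exp_sub]
    exact hI.div_const _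

/-- Both moment generating functions equal `exp (s ^ 2 Var Z / 2 + s θ cov(Z, W))`: the cross term
in the variance of `s Z + θ W` is the shift. -/
theorem map_gaussianTilt {Z W : Ω → ℝ} (h : HasGaussianLaw (fun ω => (Z ω, W ω)) P)
    (hZ : P[Z] = 0) (hW : P[W] = 0) (θ : ℝ) :
    (gaussianTilt W P θ).map Z = P.map fun ω => Z ω + θ * cov[Z, W; P] := by
  have := h.isProbabilityMeasure
  have := isProbabilityMeasure_gaussianTilt h.snd hW θ
  have hZm : AEMeasurable Z P := h.fst.aemeasurable
  have hWm : AEMeasurable W P := h.snd.aemeasurable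
  have hmgf : mgf Z (gaussianTilt W P θ) = mgf (fun ω => Z ω + θ * cov[Z, W; P]) P := by
    ext s
    have hlin : HasGaussianLaw (fun ω => s * Z ω + θ * W ω) P :=
      h.map_fun (s • ContinuousLinearMap.fst ℝ ℝ ℝ + θ • ContinuousLinearMap.snd ℝ ℝ ℝ)
    have h0 : P[fun ω => s * Z ω + θ * W ω] = 0 := by
      rw [integral_add (h.fst.integrable.const_mul s) (h.snd.integrable.const_mul θ),
        integral_const_mul, integral_const_mul, hZ, hW]
      simp
    have hvar : Var[fun ω => s * Z ω + θ * W ω; P] =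
        s ^ 2 * Var[Z; P] + 2 * (s * θ * cov[Z, W; P]) + θ ^ 2 * Var[W; P] := by
      rw [variance_fun_add (h.fst.memLp_two.const_mul s) (h.snd.memLp_two.const_mul θ),
        variance_const_mul, variance_const_mul, covariance_const_mul_left,
        covariance_const_mul_right]
      ring
    have hm := hlin.mgf_eq_of_centered h0 1
    rw [mgf, integral_gaussianTilt hWm, mgf_add_const, h.fst.mgf_eq_of_centered hZ]
    calc ∫ ω, Real.exp (θ * W ω - θ ^ 2 * Var[W; P] / 2) * Real.exp (s * Z ω) ∂P
        = Real.exp (-(θ ^ 2 * Var[W; P] / 2)) * mgf (fun ω => s * Z ω + θ * W ω) P 1 := by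
          rw [mgf, ← integral_const_mul]
          congr with ω
          rw [← Real.exp_add, ← Real.exp_add]
          ring_nf
      _ = _ := by
          rw [hm, hvar, ← Real.exp_add, ← Real.exp_add]
          ring_nf
  refine Measure.ext_of_complexMGF_eq (hZm.mono_ac (withDensity_absolutelyContinuous _ _))
    (by fun_prop) ?_
  -- A nonintegrable exponential would have `mgf` equal to `0`, so positivity gives integrability
  -- for all `s`, and the complex functions agree on the whole plane.
  have hint : integrableExpSet Z (gaussianTilt W P θ) = Set.univ := by
    ext s
    refine ⟨fun _ => trivial, fun _ => ?_⟩
    rw [integrableExpSet, Set.mem_ofPred_eq, ← mgf_pos_iff, hmgf, mgf_add_const,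
      h.fst.mgf_eq_of_centered hZ]
    positivity
  have heq := eqOn_complexMGF_of_mgf hmgf
  ext z
  exact heq (by simp [hint])

end Tilt

/-! ### Girsanov's theorem. -/

/-- **Girsanov's theorem** for a constant drift and finite-dimensional marginals. -/
theorem ProbabilityTheory.IsPreBrownianReal.map_gaussianTilt_restrict
    {Ω : Type*} [MeasurableSpace Ω] {P : Measure Ω} {X : ℝ≥0 → Ω → ℝ}
    (hX : IsPreBrownianReal X P) (S : ℝ≥0) (θ : ℝ) (I : Finset (Set.Iic S)) :
    (gaussianTilt (X S) P θ).map (fun ω (u : I) => X u ω) =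
      P.map fun ω (u : I) => X u ω + θ * (u : ℝ≥0) := by
  classical
  have hS := (hX.isGaussianProcess.hasGaussianLaw_eval S)
  have := hS.isProbabilityMeasure
  have := isProbabilityMeasure_gaussianTilt hS (hX.integral_eval S) θ
  have hm (u : ℝ≥0) : AEMeasurable (X u) P := hX.aemeasurable u
  have hm' : AEMeasurable (fun ω (u : I) => X u ω) (gaussianTilt (X S) P θ) :=
    (aemeasurable_pi_lambda _ fun u : I => hm u).mono_ac (withDensity_absolutelyContinuous _ _)
  refine Measure.ext_of_charFunDual ?_
  ext L
  -- Cramér–Wold reduces to one functional `L`; `S` is adjoined so that `L` of the path and `X S`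
  -- are jointly Gaussian.
  let J : Finset ℝ≥0 := insert S (I.image Subtype.val)
  have hJ (u : I) : (u : ℝ≥0) ∈ J :=
    Finset.mem_insert_of_mem (Finset.mem_image_of_mem _ u.2)
  let R : (J → ℝ) →L[ℝ] (I → ℝ) := ContinuousLinearMap.pi fun u => .proj ⟨u, hJ u⟩
  have hpair : HasGaussianLaw (fun ω => (L (fun u : I => X u ω), X S ω)) P :=
    (hX.isGaussianProcess.hasGaussianLaw J).map_fun
      ((L.comp R).prod (.proj (⟨S, Finset.mem_insert_self _ _⟩ : J)))
  obtain ⟨c, hL⟩ : ∃ c : I → ℝ, ∀ x : I → ℝ, L x = ∑ u, x u * c u := by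
    refine ⟨fun u => L (Pi.single u 1), fun x => ?_⟩
    conv_lhs => rw [← Finset.univ_sum_single x]
    rw [map_sum]
    refine Finset.sum_congr rfl fun u _ => ?_
    rw [← smul_eq_mul, ← map_smul, ← Pi.single_smul, smul_eq_mul, mul_one]
  have h0 : ∫ ω, L (fun u : I => X u ω) ∂P = 0 := by
    simp_rw [hL]
    rw [integral_finsetSum _ fun (u : I) _ => (hX.integrable_eval u).mul_const _]
    simp_rw [integral_mul_const, hX.integral_eval]
    simp
  have hcov : cov[fun ω => L (fun u : I => X u ω), X S; P] = L fun u : I => ((u : ℝ≥0) : ℝ) := by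
    simp_rw [hL]
    rw [covariance_fun_sum_left'
      (fun u _ => (hX.isGaussianProcess.hasGaussianLaw_eval _).memLp_two.mul_const _) hS.memLp_two]
    refine Finset.sum_congr rfl fun u _ => ?_
    -- The covariance `min u S` is the linear drift `u` because `u ≤ S`.
    rw [covariance_mul_const_left, hX.covariance_eval, min_eq_left (Set.mem_Iic.1 u.1.2)]
  have htilt := map_gaussianTilt hpair h0 (hX.integral_eval S) θ
  rw [charFunDual_eq_charFun_map_one, charFunDual_eq_charFun_map_one,
    AEMeasurable.map_map_of_aemeasurable (by fun_prop) hm',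
    AEMeasurable.map_map_of_aemeasurable (by fun_prop) (by fun_prop)]
  refine congrArg (fun μ => charFun μ 1) (htilt.trans ?_)
  rw [hcov]
  congr with ω
  simp only [Function.comp_apply]
  rw [← smul_eq_mul, ← map_smul, ← map_add]
  rfl

/-- **Girsanov's theorem** for a constant drift, up to a deterministic time. -/
theorem ProbabilityTheory.IsPreBrownianReal.map_gaussianTilt
    {Ω : Type*} [MeasurableSpace Ω] {P : Measure Ω} {X : ℝ≥0 → Ω → ℝ}
    (hX : IsPreBrownianReal X P) (hm : ∀ u, Measurable (X u)) (S : ℝ≥0) (θ : ℝ) :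
    (gaussianTilt (X S) P θ).map (fun ω (u : Set.Iic S) => X u ω) =
      P.map fun ω (u : Set.Iic S) => X u ω + θ * (u : ℝ≥0) := by
  have hS := (hX.isGaussianProcess.hasGaussianLaw_eval S)
  have := hS.isProbabilityMeasure
  have := isProbabilityMeasure_gaussianTilt hS (hX.integral_eval S) θ
  have h1 := isProjectiveLimit_map (X := fun (u : Set.Iic S) ω => X u ω)
    (P := gaussianTilt (X S) P θ) (measurable_pi_lambda _ fun u : Set.Iic S => hm u).aemeasurable
  have h2 := isProjectiveLimit_map (X := fun (u : Set.Iic S) ω => X u ω + θ * (u : ℝ≥0))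
    (P := P) (measurable_pi_lambda _ fun u : Set.Iic S => (hm u).add_const _).aemeasurable
  refine IsProjectiveLimit.unique ?_ h2
  intro I
  rw [h1 I]
  exact hX.map_gaussianTilt_restrict S θ I

/-! ### Change of measure on path space, with `σ` frozen. -/

section PathSpace

variable (x v : ℝ) (T : ℝ≥0)

/-- The process `(X, γ)` on `[0, T]` as a functional of the paths of `B` and `σ`. -/
noncomputable def priceAgePath (p : (ℚ≥0 → ℝ) × (ℚ≥0 → ℝ)) (t : Set.Icc (0 : ℝ≥0) T) : ℝ × ℝ :=
  (Real.exp (evalPath p.1 (undershootPath p.2 t)), (t : ℝ≥0) - v - undershootPath p.2 t)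

/-- The process `(X exp (-H / 2), γ)` on `[0, T]` as a functional of the paths of `B` and `σ`. -/
noncomputable def discountedPriceAgePath (p : (ℚ≥0 → ℝ) × (ℚ≥0 → ℝ))
    (t : Set.Icc (0 : ℝ≥0) T) : ℝ × ℝ :=
  (Real.exp (evalPath p.1 (undershootPath p.2 t)) * Real.exp (-undershootPath p.2 t / 2),
    (t : ℝ≥0) - v - undershootPath p.2 t)

/-- The density of the change of measure as a functional of the paths of `B` and `σ`. -/
noncomputable def densityPath (p : (ℚ≥0 → ℝ) × (ℚ≥0 → ℝ)) : ℝ≥0∞ :=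
  ENNReal.ofReal (Real.exp
    (-(evalPath p.1 (undershootPath p.2 T) - x) / 2 - undershootPath p.2 T / 8))

theorem measurable_undershootPath_snd (t : ℝ≥0) :
    Measurable fun p : (ℚ≥0 → ℝ) × (ℚ≥0 → ℝ) => undershootPath p.2 t :=
  (measurable_undershootPath t).comp measurable_snd

theorem measurable_evalPath_undershootPath (t : ℝ≥0) :
    Measurable fun p : (ℚ≥0 → ℝ) × (ℚ≥0 → ℝ) => evalPath p.1 (undershootPath p.2 t) :=
  measurable_fst.evalPath (measurable_undershootPath_snd t)

theorem measurable_evalPath_left (u : ℝ≥0) : Measurable fun w => evalPath w u :=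
  measurable_id.evalPath measurable_const

theorem measurable_priceAgePath : Measurable (priceAgePath v T) :=
  measurable_pi_lambda _ fun t =>
    (measurable_evalPath_undershootPath t).exp.prodMk
      ((measurable_undershootPath_snd t).coe_nnreal_real.const_sub _)

theorem measurable_discountedPriceAgePath : Measurable (discountedPriceAgePath v T) :=
  measurable_pi_lambda _ fun t =>
    ((measurable_evalPath_undershootPath t).exp.mul
      ((measurable_undershootPath_snd t).coe_nnreal_real.neg.div_const 2).exp).prodMk
      ((measurable_undershootPath_snd t).coe_nnreal_real.const_sub _)

theorem measurable_densityPath : Measurable (densityPath x T) :=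
  ((((measurable_evalPath_undershootPath T).sub_const x).neg.div_const 2).sub
    ((measurable_undershootPath_snd T).coe_nnreal_real.div_const 8)).exp.ennreal_ofReal

variable {x v T} {μ ν : Measure (ℚ≥0 → ℝ)}

theorem gaussianTilt_eq_withDensity_densityPath
    (hX : IsPreBrownianReal (fun u w => evalPath w u - x) μ) (s : ℚ≥0 → ℝ) :
    gaussianTilt (fun w => evalPath w (undershootPath s T) - x) μ (-1 / 2) =
      μ.withDensity fun w => densityPath x T (w, s) := by
  have hvar : Var[fun w => evalPath w (undershootPath s T) - x; μ] = undershootPath s T := by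
    rw [(hX.hasLaw_eval _).variance_eq, variance_id_gaussianReal]
  rw [gaussianTilt, hvar]
  congr with w
  rw [densityPath]
  ring_nf

theorem withDensity_densityPath_apply (hX : IsPreBrownianReal (fun u w => evalPath w u - x) μ)
    (s : ℚ≥0 → ℝ) {A : Set (Set.Icc (0 : ℝ≥0) T → ℝ × ℝ)} (hA : MeasurableSet A) :
    μ.withDensity (fun w => densityPath x T (w, s)) {w | priceAgePath v T (w, s) ∈ A} =
      μ {w | discountedPriceAgePath v T (w, s) ∈ A} := by
  have hm (u : ℝ≥0) : Measurable fun w => evalPath w u - x :=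
    (measurable_evalPath_left u).sub_const x
  have hgir := hX.map_gaussianTilt hm (undershootPath s T) (-1 / 2)
  have hle (t : Set.Icc (0 : ℝ≥0) T) : undershootPath s t ≤ undershootPath s T :=
    monotone_undershootPath s t.2.2
  -- One map `Φ` yields both processes, from the centered path and from the drifted one.
  obtain ⟨Φ, hΦ, hΦ_apply⟩ : ∃ Φ : (Set.Iic (undershootPath s T) → ℝ) →
      Set.Icc (0 : ℝ≥0) T → ℝ × ℝ, Measurable Φ ∧ ∀ y t, Φ y t =
        (Real.exp (x + y ⟨undershootPath s t, hle t⟩), (t : ℝ≥0) - v - undershootPath s t) := by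
    refine ⟨_, measurable_pi_lambda _ fun t => Measurable.prodMk ?_ measurable_const,
      fun _ _ => rfl⟩
    fun_prop
  have h1 (w : ℚ≥0 → ℝ) : priceAgePath v T (w, s) =
      Φ fun u : Set.Iic (undershootPath s T) => evalPath w u - x := by
    funext t
    rw [hΦ_apply, priceAgePath, add_sub_cancel]
  have h2 (w : ℚ≥0 → ℝ) : discountedPriceAgePath v T (w, s) =
      Φ fun u : Set.Iic (undershootPath s T) => evalPath w u - x + -1 / 2 * (u : ℝ≥0) := by
    funext t
    rw [hΦ_apply, discountedPriceAgePath, ← Real.exp_add]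
    ring_nf
  simp_rw [h1, h2]
  rw [← gaussianTilt_eq_withDensity_densityPath hX s]
  have h := congrArg (fun m => m (Φ ⁻¹' A)) hgir
  rw [Measure.map_apply (measurable_pi_lambda _ fun u : Set.Iic _ => hm u) (hΦ hA),
    Measure.map_apply (measurable_pi_lambda _ fun u : Set.Iic _ => (hm u).add_const _)
      (hΦ hA)] at h
  exact h

theorem map_priceAgePath_withDensity [SFinite ν]
    (hX : IsPreBrownianReal (fun u w => evalPath w u - x) μ) :
    ((μ.prod ν).withDensity (densityPath x T)).map (priceAgePath v T) =
      (μ.prod ν).map (discountedPriceAgePath v T) := by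
  have := hX.isGaussianProcess.isProbabilityMeasure
  ext A hA
  have hA' := measurable_priceAgePath v T hA
  rw [Measure.map_apply (measurable_priceAgePath v T) hA,
    Measure.map_apply (measurable_discountedPriceAgePath v T) hA,
    Measure.prod_apply_symm (measurable_discountedPriceAgePath v T hA),
    withDensity_apply _ hA', ← lintegral_indicator hA',
    lintegral_prod_symm' _ ((measurable_densityPath x T).indicator hA')]
  refine lintegral_congr fun s => ?_
  refine Eq.trans ?_ (withDensity_densityPath_apply hX s hA)
  have hs : MeasurableSet {w | priceAgePath v T (w, s) ∈ A} :=
    hA'.preimage measurable_prodMk_right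
  refine Eq.trans ?_ (withDensity_apply _ hs).symm
  exact lintegral_indicator hs fun w => densityPath x T (w, s)

/-- The equality of image laws, evaluated on the whole space, gives total mass one; any `v` would
serve. -/
theorem isProbabilityMeasure_withDensity_densityPath [IsProbabilityMeasure ν]
    (hX : IsPreBrownianReal (fun u w => evalPath w u - x) μ) :
    IsProbabilityMeasure ((μ.prod ν).withDensity (densityPath x T)) := by
  have := hX.isGaussianProcess.isProbabilityMeasure
  constructor
  have h := congrArg (fun m => m Set.univ) (map_priceAgePath_withDensity (v := 0) (T := T)
    (ν := ν) hX)
  rw [Measure.map_apply (measurable_priceAgePath 0 T) .univ,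
    Measure.map_apply (measurable_discountedPriceAgePath 0 T) .univ] at h
  simpa using h

end PathSpace

/-! ### Transfer to the original probability space. -/

namespace IsBrownianSubordinatorPair

variable {Ω : Type*} [MeasurableSpace Ω] {P : Measure Ω} {φ : ℝ → ℝ} {x v : ℝ}
  {B σ : ℝ≥0 → Ω → ℝ}

theorem aemeasurable_brownian_rat (h : IsBrownianSubordinatorPair φ x v B σ P) :
    AEMeasurable (fun ω (q : ℚ≥0) => B q ω) P :=
  aemeasurable_pi_lambda _ fun q => by
    simpa using (h.brownian.aemeasurable q).add_const x

theorem aemeasurable_subordinator_rat (h : IsBrownianSubordinatorPair φ x v B σ P) :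
    AEMeasurable (fun ω (q : ℚ≥0) => σ q ω) P := by
  refine aemeasurable_pi_lambda _ fun q => ?_
  refine ((h.subordinator.aemeasurable q).add_const v).congr ?_
  filter_upwards [h.start] with ω hω
  simp [hω]

theorem ae_evalPath_eq (h : IsBrownianSubordinatorPair φ x v B σ P) :
    ∀ᵐ ω ∂P, ∀ u : ℝ≥0, evalPath (fun q => B q ω) u = B u ω := by
  filter_upwards [h.brownian.cont] with ω hω u
  refine evalPath_eq (f := fun u => B u ω) ?_ u
  simpa using hω.add_const x

theorem ae_undershoot_eq (h : IsBrownianSubordinatorPair φ x v B σ P) (hφ : 0 < φ 1) :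
    ∀ᵐ ω ∂P, ∀ t : ℝ≥0, undershoot σ t ω = undershootPath (fun q => σ q ω) t ∧
      age σ t ω = t - v - undershootPath (fun q => σ q ω) t := by
  filter_upwards [h.start, h.subordinator.monotone, h.subordinator.ae_unbounded hφ]
    with ω hv hmono hunb t
  have hmono' : Monotone fun u => σ u ω := fun a b hab => by simpa using hmono hab
  have hunb' (a : ℝ) : ∃ u, a < σ u ω := by
    obtain ⟨u, hu⟩ := hunb (a - σ 0 ω)
    exact ⟨u, by linarith⟩
  have hU : undershoot σ t ω = undershootPath (fun q => σ q ω) t :=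
    leftLim_sInf_eq_undershootPath hmono' hunb' t
  refine ⟨hU, ?_⟩
  rw [← hU, undershoot, leftLim_sub_const hmono', hv, age]
  ring

theorem isPreBrownianReal_evalPath (h : IsBrownianSubordinatorPair φ x v B σ P) :
    IsPreBrownianReal (fun u w => evalPath w u - x) (P.map fun ω (q : ℚ≥0) => B q ω) where
  hasLaw I := by
    have hm : Measurable fun w (u : I) => evalPath w u - x :=
      measurable_pi_lambda _ fun u : I => (measurable_evalPath_left u).sub_const x
    refine ⟨hm.aemeasurable, ?_⟩
    refine (AEMeasurable.map_map_of_aemeasurable hm.aemeasurable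
      h.aemeasurable_brownian_rat).trans ?_
    rw [← (h.brownian.hasLaw I).map_eq]
    refine Measure.map_congr ?_
    filter_upwards [h.ae_evalPath_eq] with ω hω
    ext u
    simp [hω]

theorem map_paths (h : IsBrownianSubordinatorPair φ x v B σ P) [IsFiniteMeasure P] :
    P.map (fun ω => ((fun q : ℚ≥0 => B q ω), (fun q : ℚ≥0 => σ q ω))) =
      (P.map fun ω (q : ℚ≥0) => B q ω).prod (P.map fun ω (q : ℚ≥0) => σ q ω) := by
  refine IndepFun.map_prod_eq_prod_map_map h.aemeasurable_brownian_rat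
    h.aemeasurable_subordinator_rat ?_
  exact h.indep.comp (φ := fun w (q : ℚ≥0) => w q) (ψ := fun w (q : ℚ≥0) => w q)
    (by fun_prop) (by fun_prop)

end IsBrownianSubordinatorPair

theorem MeasureTheory.map_withDensity_comp {Ω E : Type*} [MeasurableSpace Ω] [MeasurableSpace E]
    {P : Measure Ω} {f : Ω → E} (hf : AEMeasurable f P) {g : E → ℝ≥0∞} (hg : Measurable g) :
    (P.withDensity fun ω => g (f ω)).map f = (P.map f).withDensity g := by
  ext A hA
  rw [withDensity_apply _ hA, Measure.map_apply_of_aemeasurable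
    (hf.mono_ac (withDensity_absolutelyContinuous _ _)) hA,
    withDensity_apply₀ _ (hf.nullMeasurable hA),
    Measure.restrict_map_of_aemeasurable hf hA, lintegral_map' hg.aemeasurable hf.restrict]

theorem lemma6 {Ω : Type*} [MeasurableSpace Ω] (P : Measure Ω) [IsProbabilityMeasure P]
    (φ : ℝ → ℝ) (hφ : IsBernsteinZero φ) (x v : ℝ) (B σ : ℝ≥0 → Ω → ℝ)
    (h : IsBrownianSubordinatorPair φ x v B σ P) (T : ℝ≥0) (hT : 0 < T) :
    IsProbabilityMeasure (changedMeasure B σ x T P) ∧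
      IdentDistrib
        (fun ω (t : Set.Icc (0 : ℝ≥0) T) => (price B σ t ω, age σ t ω))
        (fun ω (t : Set.Icc (0 : ℝ≥0) T) =>
          (price B σ t ω * Real.exp (-undershoot σ t ω / 2), age σ t ω))
        (changedMeasure B σ x T P) P := by
  set f : Ω → (ℚ≥0 → ℝ) × (ℚ≥0 → ℝ) := fun ω => (fun q => B q ω, fun q => σ q ω) with hf
  have hfm : AEMeasurable f P :=
    h.aemeasurable_brownian_rat.prodMk h.aemeasurable_subordinator_rat
  have hX := h.isPreBrownianReal_evalPath
  have := Measure.isProbabilityMeasure_map (μ := P) h.aemeasurable_subordinator_rat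
  have hQ : changedMeasure B σ x T P = P.withDensity fun ω => densityPath x T (f ω) := by
    refine withDensity_congr_ae ?_
    filter_upwards [h.ae_evalPath_eq, h.ae_undershoot_eq hφ.pos] with ω hB hσ
    simp [densityPath, hf, logPrice, (hσ T).1, hB]
  -- Identities between processes and path functionals hold only `P`-a.e.; absolute continuity
  -- carries them to the changed measure.
  have hac : changedMeasure B σ x T P ≪ P := withDensity_absolutelyContinuous _ _
  have hfQ : AEMeasurable f (changedMeasure B σ x T P) := hfm.mono_ac hac
  have hmapQ : (changedMeasure B σ x T P).map f = (P.map f).withDensity (densityPath x T) := by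
    rw [hQ, map_withDensity_comp hfm (measurable_densityPath x T)]
  have h1 : (fun ω (t : Set.Icc (0 : ℝ≥0) T) => (price B σ t ω, age σ t ω)) =ᵐ[P]
      priceAgePath v T ∘ f := by
    filter_upwards [h.ae_evalPath_eq, h.ae_undershoot_eq hφ.pos] with ω hB hσ
    ext t <;> simp [priceAgePath, hf, price, logPrice, hσ, hB]
  have h2 : (fun ω (t : Set.Icc (0 : ℝ≥0) T) =>
      (price B σ t ω * Real.exp (-undershoot σ t ω / 2), age σ t ω)) =ᵐ[P]
      discountedPriceAgePath v T ∘ f := by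
    filter_upwards [h.ae_evalPath_eq, h.ae_undershoot_eq hφ.pos] with ω hB hσ
    ext t <;> simp [discountedPriceAgePath, hf, price, logPrice, hσ, hB]
  have h1Q := hac.ae_eq h1
  have hm1 := measurable_priceAgePath v T
  have hm2 := measurable_discountedPriceAgePath v T
  refine ⟨?_, (hm1.comp_aemeasurable hfQ).congr h1Q.symm,
    (hm2.comp_aemeasurable hfm).congr h2.symm, ?_⟩
  · have hp := isProbabilityMeasure_withDensity_densityPath (T := T)
      (ν := P.map fun ω (q : ℚ≥0) => σ q ω) hX
    rw [← h.map_paths, ← hmapQ] at hp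
    exact Measure.isProbabilityMeasure_of_map f
  · rw [Measure.map_congr h1Q, Measure.map_congr h2,
      ← AEMeasurable.map_map_of_aemeasurable hm1.aemeasurable hfQ,
      ← AEMeasurable.map_map_of_aemeasurable hm2.aemeasurable hfm, hmapQ, h.map_paths]
    exact map_priceAgePath_withDensity hX
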